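/- Let $\mathbb{C}[x_{ij} : 1\le i,j\le n]_d$ denote the space of complex homogeneous polynomials (forms) of degree $d$ in $n^2$ variables. The symmetric rank $R_s(P)$ of a form $P$ of degree $d$ is the least $r\in\mathbb{N}$ such that $P=\sum_{i=1}^r \ell_i^{\,d}$ for some linear forms $\ell_1,\dots,\ell_r$. The symmetric border rank $\underline{R}_s(P)$ is the least $r\in\mathbb{N}$ such that $P$ lies in the Zariski closure, within the space of forms of degree $d$, of the set $\{T : R_s(T)=r\}$. Let $\det_n$ be the determinant of the $n\times n$ matrix of variables $(x_{ij})$, a form of degree $n$. **Theorem.** Let $n\ge 3$. If $n$ is even, then $$\underline{R}_s(\det\nolimits_n)\ \ge\ \left(1+\frac{4}{(n-1)(n+2)^2}\right)\binom{n}{n/2}^2 .$$ If $n$ is odd, then $$\underline{R}_s(\det\nolimits_n)\ \ge\ \left(1+\frac{8}{(n-1)(n+3)^2}\right)\binom{n}{(n-1)/2}^2 .$$ -/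

import Mathlib

open scoped BigOperators

noncomputable section

namespace DetBorderRank

/-- The set of all `r` such that `P` is a sum of `r` many `d`-th powers of linear forms. -/
def powerSumLengths {σ : Type*} (d : ℕ) (P : MvPolynomial σ ℂ) : Set ℕ :=
  {r | ∃ v : Fin r → MvPolynomial σ ℂ, (∀ i, (v i).IsHomogeneous 1) ∧ P = ∑ i, v i ^ d}

/-- The symmetric (Waring) rank of a form `P ∈ S^d V`, where `V` is the complex vector space of
linear forms in the variables `σ`; the minimum over the empty set is `⊤`. -/
def symmetricRank {σ : Type*} (d : ℕ) (P : MvPolynomial.homogeneousSubmodule σ ℂ d) : ℕ∞ :=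
  ⨅ r ∈ powerSumLengths d (P : MvPolynomial σ ℂ), (r : ℕ∞)

/-- The Zariski closure of a subset `S` of a complex vector space `W`: the common zeros of all
polynomial functions on `W` that vanish on `S`. A polynomial function on `W` is a polynomial
expression in linear functionals on `W`. -/
def zariskiClosure {W : Type*} [AddCommGroup W] [Module ℂ W] (S : Set W) : Set W :=
  {w | ∀ f : MvPolynomial (Module.Dual ℂ W) ℂ,
    (∀ s ∈ S, MvPolynomial.eval (fun φ : Module.Dual ℂ W => φ s) f = 0) →
      MvPolynomial.eval (fun φ : Module.Dual ℂ W => φ w) f = 0}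

/-- The symmetric border rank of a form `P ∈ S^d V`: the least `r` such that `P` lies in the
Zariski closure, inside `S^d V`, of the set of forms of symmetric rank `r`. -/
def symmetricBorderRank {σ : Type*} (d : ℕ) (P : MvPolynomial.homogeneousSubmodule σ ℂ d) : ℕ∞ :=
  ⨅ r ∈ {r : ℕ | P ∈ zariskiClosure {T | symmetricRank d T = (r : ℕ∞)}}, (r : ℕ∞)

/-- The determinant of the generic `n × n` matrix is a form of degree `n`. -/
theorem det_isHomogeneous (n : ℕ) :
    (Matrix.mvPolynomialX (Fin n) (Fin n) ℂ).det.IsHomogeneous n := by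
  rw [Matrix.det_apply']
  refine MvPolynomial.IsHomogeneous.sum _ _ _ fun τ _ => ?_
  have hprod := MvPolynomial.IsHomogeneous.prod Finset.univ
    (fun i => Matrix.mvPolynomialX (Fin n) (Fin n) ℂ (τ i) i) (fun _ => 1)
    (fun i _ => MvPolynomial.isHomogeneous_X ℂ (τ i, i))
  have hsign : (((Equiv.Perm.sign τ : ℤˣ) : ℤ) : MvPolynomial (Fin n × Fin n) ℂ) =
      MvPolynomial.C (((Equiv.Perm.sign τ : ℤˣ) : ℤ) : ℂ) := by simp
  rw [hsign]
  simpa using hprod.C_mul (((Equiv.Perm.sign τ : ℤˣ) : ℤ) : ℂ)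

/-- The `n × n` determinant polynomial `det_n`, as an element of `S^n V` with `dim V = n ^ 2`. -/
def detForm (n : ℕ) : MvPolynomial.homogeneousSubmodule (Fin n × Fin n) ℂ n :=
  ⟨(Matrix.mvPolynomialX (Fin n) (Fin n) ℂ).det,
    (MvPolynomial.mem_homogeneousSubmodule n _).2 (det_isHomogeneous n)⟩

end DetBorderRank

end

/-!
Polarizing a form `P` of degree `d + q` turns its order-`d` partial derivatives into symmetric
tensors `∂ₘ P`, and the Koszul flattening sends `∑ c (m, a) ∂ₘ P ⊗ a` to the tensor in which `a` is
wedged with the first slot of `∂ₘ P`. A power `ℓ ^ (d + q)` contributes rank at most `N - 1` in `N`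
variables, because its flattening factors through the wedge of a vector with `ℓ`; since the locus
where a family of linear maps has rank at most `k` is Zariski closed, a form of border rank `r` has
flattening of rank at most `r * (N - 1)`.

For the generic determinant of size `n = d + q` the partial derivatives are, up to sign, the minors
of size `q`. An element of the kernel is a tensor with `q + 1` slots that is symmetric in all of
them and alternates in the row indices and in the column indices, hence the kernel has dimension at
most `n.choose (q + 1) ^ 2`. Comparing with the dimension `n.choose q ^ 2 * n ^ 2` of the domain
gives the bound, which is applied with `q = d` and with `q = d + 1`.
-/

noncomputable section

namespace DetBorderRank

open MvPolynomial

section ZariskiClosure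

variable {W E F : Type*} [AddCommGroup W] [Module ℂ W] [AddCommGroup E] [Module ℂ E]
  [AddCommGroup F] [Module ℂ F] {S : Set W} {w : W}

theorem det_eq_zero_of_mem_zariskiClosure {ι : Type*} [Finite ι]
    (A : W →ₗ[ℂ] (ι → ℂ) →ₗ[ℂ] (ι → ℂ)) (hS : ∀ s ∈ S, LinearMap.det (A s) = 0)
    (hw : w ∈ zariskiClosure S) : LinearMap.det (A w) = 0 := by
  classical
  cases nonempty_fintype ι
  let entry (i j : ι) : Module.Dual ℂ W := LinearMap.proj i ∘ₗ A.flip (Pi.single j 1)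
  have eval_det (x : W) : eval (fun φ : Module.Dual ℂ W => φ x)
      (Matrix.of fun i j => X (entry i j)).det = LinearMap.det (A x) := by
    rw [RingHom.map_det, ← LinearMap.det_toMatrix']
    congr 1
    ext i j
    simp [entry, LinearMap.toMatrix'_apply]
  rw [← eval_det]
  exact hw _ fun s hs => (eval_det s).trans (hS s hs)

theorem rank_le_of_mem_zariskiClosure (K : W →ₗ[ℂ] E →ₗ[ℂ] F) {k : ℕ}
    (hS : ∀ s ∈ S, (K s).rank ≤ k) (hw : w ∈ zariskiClosure S) : (K w).rank ≤ k := by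
  classical
  by_contra! hlt
  have succ_le_rank : ((k + 1 : ℕ) : Cardinal) ≤ (K w).rank := by
    simpa using Order.succ_le_of_lt hlt
  obtain ⟨t, card_t, hind⟩ :=
    LinearMap.le_rank_iff_exists_linearIndependent_finset.1 succ_le_rank
  let P := Fintype.linearCombination ℂ fun x : (t : Set E) => (x : E)
  have injective_comp_iff (x : W) : Function.Injective (K x ∘ₗ P) ↔
      LinearIndependent ℂ fun y : (t : Set E) => K x y := by
    rw [linearIndependent_iff_injective_fintypeLinearCombination]
    congr! 1
    ext c
    simp [P, Fintype.linearCombination_apply]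
  obtain ⟨L, hL⟩ := LinearMap.exists_leftInverse_of_injective (K w ∘ₗ P)
    (LinearMap.ker_eq_bot.2 ((injective_comp_iff w).2 hind))
  have det_compression : LinearMap.det (((K.compr₂ L).compl₂ P) w) = 0 := by
    refine det_eq_zero_of_mem_zariskiClosure _ (fun s hs => ?_) hw
    by_contra hdet
    have injective_compression : Function.Injective (L ∘ₗ K s ∘ₗ P) :=
      LinearMap.ker_eq_bot.1 (not_not.1 (mt LinearMap.det_eq_zero_iff_ker_ne_bot.2 hdet))
    have succ_le : ((k + 1 : ℕ) : Cardinal) ≤ (K s).rank :=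
      LinearMap.le_rank_iff_exists_linearIndependent_finset.2
        ⟨t, card_t, (injective_comp_iff s).1 (injective_compression.of_comp (f := L))⟩
    exact (Nat.lt_succ_self k).not_ge (Nat.cast_le.1 (succ_le.trans (hS s hs)))
  have compression_eq_id : ((K.compr₂ L).compl₂ P) w = LinearMap.id := hL
  simp [compression_eq_id] at det_compression

end ZariskiClosure

theorem mem_powerSumLengths_of_symmetricRank_eq {σ : Type*} {d r : ℕ}
    {T : homogeneousSubmodule σ ℂ d} (h : symmetricRank d T = r) :
    r ∈ powerSumLengths d (T : MvPolynomial σ ℂ) := by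
  rcases (powerSumLengths d (T : MvPolynomial σ ℂ)).eq_empty_or_nonempty with hempty | hne
  · simp [symmetricRank, hempty] at h
  · rw [symmetricRank, ← ENat.natCast_sInf hne, ENat.natCast_inj] at h
    exact h ▸ Nat.sInf_mem hne

section Polarization

variable {R σ ι : Type*} [CommRing R] [DecidableEq σ] [Fintype ι]

/-- The polarization of a form of degree `card ι` at the coordinate vectors `e (b k)`: the
coefficient of `∏ k, y k` in the value of the form at the generic vector `∑ k, y k • e (b k)`.
No division by factorials is involved, so a power `ℓ ^ n` polarizes to `n !` times a product. -/
def polarization (b : ι → σ) : MvPolynomial σ R →ₗ[R] R :=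
  lcoeff R (Finsupp.equivFunOnFinite.symm 1) ∘ₗ
    (aeval fun a : σ => ∑ k, if b k = a then (X k : MvPolynomial ι R) else 0).toLinearMap

theorem aeval_sum_ite_X_of_isHomogeneous_one (b : ι → σ) {ℓ : MvPolynomial σ R}
    (hℓ : ℓ.IsHomogeneous 1) :
    aeval (fun a : σ => ∑ k, if b k = a then (X k : MvPolynomial ι R) else 0) ℓ =
      ∑ k, ℓ.coeff (Finsupp.single (b k) 1) • X k := by
  have hspan : ℓ ∈ Submodule.span R (Set.range X) := by
    rwa [← homogeneousSubmodule_one_eq_span_X, mem_homogeneousSubmodule]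
  obtain ⟨c, rfl⟩ := Finsupp.mem_span_range_iff_exists_finsupp.1 hspan
  have coeff_eq (a : σ) : (c.sum fun i r => r • (X i : MvPolynomial σ R)).coeff
      (Finsupp.single a 1) = c a := by
    simp [Finsupp.sum, coeff_sum, coeff_X, Finsupp.single_left_inj]
  simp_rw [coeff_eq]
  simp only [Finsupp.sum, map_sum, map_smul, aeval_X, Finset.smul_sum, smul_ite, smul_zero]
  rw [Finset.sum_comm]
  refine Finset.sum_congr rfl fun k _ => ?_
  simp +contextual

theorem polarization_pow (b : ι → σ) {ℓ : MvPolynomial σ R} (hℓ : ℓ.IsHomogeneous 1) :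
    polarization b (ℓ ^ Fintype.card ι) =
      (Fintype.card ι).factorial * ∏ k, ℓ.coeff (Finsupp.single (b k) 1) := by
  simp only [polarization, LinearMap.comp_apply, AlgHom.toLinearMap_apply, map_pow,
    aeval_sum_ite_X_of_isHomogeneous_one b hℓ, lcoeff_apply]
  rw [coeff_linearCombination_X_pow_of_fintype, if_pos]
  · have multinomial_one : (Finsupp.equivFunOnFinite.symm (1 : ι → ℕ)).multinomial =
        (Fintype.card ι).factorial := by
      simp [Finsupp.multinomial_eq, Nat.multinomial]
    simp [multinomial_one, Finsupp.prod_fintype]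
  · simp [Finsupp.sum_fintype]

end Polarization

section MapSign

variable {R ι : Type*} [CommRing R] [Fintype ι] [DecidableEq ι]

/-- The sign of a self-map of a finite type: the sign of the permutation if the map is bijective,
and `0` otherwise. -/
def mapSign (s : ι → ι) : R := ((1 : Matrix ι ι R).submatrix s id).det

theorem mapSign_comp_perm (s : ι → ι) (τ : Equiv.Perm ι) :
    (mapSign (s ∘ τ) : R) = (Equiv.Perm.sign τ : ℤ) * mapSign s := by
  simpa [mapSign, Matrix.submatrix_submatrix] using
    Matrix.det_permute τ ((1 : Matrix ι ι R).submatrix s id)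

theorem mapSign_ne_zero_iff [Nontrivial R] {s : ι → ι} :
    (mapSign s : R) ≠ 0 ↔ Function.Injective s := by
  constructor
  · contrapose!
    intro hs
    obtain ⟨i, j, hij, hne⟩ := Function.not_injective_iff.1 hs
    exact Matrix.det_zero_of_row_eq hne (funext fun a => by
      rw [Matrix.submatrix_apply, Matrix.submatrix_apply, hij])
  · intro hs
    let τ : Equiv.Perm ι := .ofBijective s (Finite.injective_iff_bijective.1 hs)
    have mapSign_eq : (mapSign s : R) = (Equiv.Perm.sign τ : ℤ) := by
      simpa [mapSign, τ] using mapSign_comp_perm (R := R) id τ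
    rw [mapSign_eq]
    rcases Int.units_eq_one_or (Equiv.Perm.sign τ) with h | h <;> simp [h]

theorem polarization_det (s t : ι → ι) :
    polarization (fun k => (s k, t k)) (Matrix.mvPolynomialX ι ι R).det =
      mapSign s * mapSign t := by
  let incidence (s : ι → ι) : Matrix ι ι (MvPolynomial ι R) :=
    C.mapMatrix ((1 : Matrix ι ι R).submatrix s id)
  have det_incidence (s : ι → ι) : (incidence s).det = C (mapSign s) :=
    (RingHom.map_det _ _).symm
  have factorization : (aeval fun a : ι × ι =>
      ∑ k, if (s k, t k) = a then (X k : MvPolynomial ι R) else 0).mapMatrix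
        (Matrix.mvPolynomialX ι ι R) =
      (incidence s).transpose * Matrix.diagonal X * incidence t := by
    ext1 i j
    simp only [AlgHom.mapMatrix_apply, Matrix.map_apply, Matrix.mvPolynomialX_apply, aeval_X,
      Matrix.mul_apply (N := incidence t), Matrix.mul_diagonal]
    refine Finset.sum_congr rfl fun k _ => ?_
    by_cases hi : s k = i <;> by_cases hj : t k = j <;>
      simp [incidence, hi, hj, Matrix.one_apply]
  have prod_X : ∏ k, X k = monomial (Finsupp.equivFunOnFinite.symm 1 : ι →₀ ℕ) (1 : R) := by
    simp [monomial_eq, Finsupp.prod_fintype]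
  rw [polarization, LinearMap.comp_apply, AlgHom.toLinearMap_apply, AlgHom.map_det,
    factorization, Matrix.det_mul, Matrix.det_mul, Matrix.det_transpose, Matrix.det_diagonal,
    det_incidence, det_incidence, prod_X, mul_right_comm, ← C_mul, lcoeff_apply, coeff_C_mul,
    coeff_monomial, if_pos rfl, mul_one]

end MapSign

section Koszul

variable {R I σ : Type*} {q : ℕ}

theorem tail_comp_swap_succ (x : Fin (q + 1) → σ) (i j : Fin q) :
    Fin.tail (x ∘ Equiv.swap i.succ j.succ) = Fin.tail x ∘ Equiv.swap i j := by
  ext k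
  simp [Fin.tail, (Fin.succ_injective q).swap_apply]

section CommRing

variable [CommRing R] [Fintype I]

/-- The contraction of a family of tensors `φ m` with `q` slots against coefficients `c (m, a)`,
a tensor with `q + 1` slots. -/
def contraction :
    (I → (Fin q → σ) → R) →ₗ[R] (I × σ → R) →ₗ[R] ((Fin (q + 1) → σ) → R) :=
  LinearMap.mk₂ R (fun φ c x => ∑ m, c (m, x 0) * φ m (Fin.tail x))
    (fun _ _ _ => by ext; simp [mul_add, Finset.sum_add_distrib])
    (fun _ _ _ => by ext; simp [Finset.mul_sum, mul_left_comm])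
    (fun _ _ _ => by ext; simp [add_mul, Finset.sum_add_distrib])
    (fun _ _ _ => by ext; simp [Finset.mul_sum, mul_assoc])

theorem contraction_apply (φ : I → (Fin q → σ) → R) (c : I × σ → R) (x : Fin (q + 1) → σ) :
    contraction φ c x = ∑ m, c (m, x 0) * φ m (Fin.tail x) := rfl

theorem contraction_injective {φ : I → (Fin q → σ) → R} (hφ : LinearIndependent R φ) :
    Function.Injective (contraction φ) := by
  refine (injective_iff_map_eq_zero _).2 fun c hc => ?_
  ext ⟨m, a⟩
  refine Fintype.linearIndependent_iff.1 hφ (fun m => c (m, a)) ?_ m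
  ext y
  simpa [contraction_apply] using congrFun hc (Fin.cons a y)

/-- The antisymmetrization `G - G ∘ (0 1)` of a tensor in its first two slots. -/
def antisymmetrization : ((Fin (q + 2) → σ) → R) →ₗ[R] ((Fin (q + 2) → σ) → R) :=
  LinearMap.id - LinearMap.funLeft R R (fun x => x ∘ Equiv.swap 0 1)

theorem antisymmetrization_apply (G : (Fin (q + 2) → σ) → R) (x : Fin (q + 2) → σ) :
    antisymmetrization G x = G x - G (x ∘ Equiv.swap 0 1) := rfl

/-- The Koszul flattening of a family of tensors `φ m`, in coordinates: the map
`∑ c (m, a) φ m ⊗ a ↦ ∑ c (m, a) (a ∧ -) φ m`, where `a ∧ -` antisymmetrizes `a` with the first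
slot of `φ m`. -/
def koszulFlattening :
    (I → (Fin (q + 1) → σ) → R) →ₗ[R] (I × σ → R) →ₗ[R] ((Fin (q + 2) → σ) → R) :=
  contraction.compr₂ antisymmetrization

theorem koszulFlattening_eq_zero_iff {φ : I → (Fin (q + 1) → σ) → R} {c : I × σ → R} :
    koszulFlattening φ c = 0 ↔
      ∀ x, contraction φ c (x ∘ Equiv.swap 0 1) = contraction φ c x := by
  simp only [koszulFlattening, LinearMap.compr₂_apply, funext_iff, antisymmetrization_apply,
    Pi.zero_apply, sub_eq_zero]
  exact forall_congr' fun _ => eq_comm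

/-- The transposition `(0 1)` and those of the slots of the tensors `φ m` generate the symmetric
group. -/
theorem contraction_comp_perm {φ : I → (Fin (q + 1) → σ) → R}
    (hφ : ∀ m x (τ : Equiv.Perm (Fin (q + 1))), φ m (x ∘ τ) = φ m x) {c : I × σ → R}
    (hc : koszulFlattening φ c = 0) (τ : Equiv.Perm (Fin (q + 2))) (x : Fin (q + 2) → σ) :
    contraction φ c (x ∘ τ) = contraction φ c x := by
  have hτ : τ ∈ Submonoid.closure
      (Set.range fun i : Fin (q + 1) => Equiv.swap i.castSucc i.succ) := by
    simp [Equiv.Perm.mclosure_swap_castSucc_succ]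
  induction hτ using Submonoid.closure_induction generalizing x with
  | one => rfl
  | mul τ₁ τ₂ _ _ ih₁ ih₂ => exact (ih₂ (x ∘ τ₁)).trans (ih₁ x)
  | mem τ hτ =>
    obtain ⟨i, rfl⟩ := hτ
    cases i using Fin.cases with
    | zero => exact koszulFlattening_eq_zero_iff.1 hc x
    | succ i =>
      refine Finset.sum_congr rfl fun m _ => ?_
      simp only [Fin.castSucc_succ, tail_comp_swap_succ, hφ, Function.comp_apply]
      rw [Equiv.swap_apply_of_ne_of_ne (Fin.succ_ne_zero _).symm (Fin.succ_ne_zero _).symm]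

/-- The map `e ↦ (e ∧ ℓ) ⊗ ℓ ⊗ ⋯ ⊗ ℓ`, that is, the wedge of a vector with the first factor of the
tensor power `ℓ ⊗ ⋯ ⊗ ℓ`. -/
def wedgePower (ℓ : σ → R) : (σ → R) →ₗ[R] ((Fin (q + 2) → σ) → R) :=
  antisymmetrization ∘ₗ LinearMap.pi fun x => (∏ k, ℓ (Fin.tail x k)) • LinearMap.proj (x 0)

theorem wedgePower_apply (ℓ e : σ → R) : wedgePower (q := q) ℓ e =
    antisymmetrization fun x => (∏ k, ℓ (Fin.tail x k)) * e (x 0) := rfl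

theorem wedgePower_self (ℓ : σ → R) : wedgePower (q := q) ℓ ℓ = 0 := by
  have prod_tail_mul (x : Fin (q + 2) → σ) : (∏ k, ℓ (Fin.tail x k)) * ℓ (x 0) = ∏ k, ℓ (x k) := by
    rw [Fin.prod_univ_succ fun k => ℓ (x k), mul_comm]
    rfl
  ext x
  simp only [wedgePower_apply, prod_tail_mul, antisymmetrization_apply]
  exact sub_eq_zero.2 (Equiv.prod_comp (Equiv.swap 0 1) fun k => ℓ (x k)).symm

theorem koszulFlattening_prod (α : I → R) (ℓ : σ → R) :
    (koszulFlattening fun m (x : Fin (q + 1) → σ) => α m * ∏ k, ℓ (x k)) =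
      wedgePower ℓ ∘ₗ LinearMap.pi fun a => ∑ m, α m • LinearMap.proj (m, a) := by
  refine LinearMap.ext fun c => congrArg antisymmetrization (funext fun x => ?_)
  simp only [contraction_apply]
  simp only [LinearMap.pi_apply, LinearMap.sum_apply, LinearMap.smul_apply, LinearMap.proj_apply,
    smul_eq_mul, Finset.mul_sum]
  exact Finset.sum_congr rfl fun m _ => by ring

end CommRing

variable {K : Type*} [Field K] [Fintype σ]

theorem rank_wedgePower_le (ℓ : σ → K) :
    (wedgePower (q := q) ℓ).rank ≤ (Fintype.card σ - 1 : ℕ) := by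
  by_cases hℓ : ℓ = 0
  · have wedgePower_eq_zero : wedgePower (q := q) ℓ = 0 := by
      refine LinearMap.ext fun e => ?_
      ext x
      simp [wedgePower_apply, antisymmetrization_apply, hℓ]
    simp [wedgePower_eq_zero]
  · have ker_pos : 0 < Module.finrank K (LinearMap.ker (wedgePower (q := q) ℓ)) :=
      Module.finrank_pos_iff_exists_ne_zero.2
        ⟨⟨ℓ, wedgePower_self ℓ⟩, fun h => hℓ (congrArg Subtype.val h)⟩
    have rank_nullity := LinearMap.finrank_range_add_finrank_ker (wedgePower (q := q) ℓ)
    rw [Module.finrank_fintype_fun_eq_card] at rank_nullity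
    rw [LinearMap.rank, ← Module.finrank_eq_rank, Nat.cast_le]
    omega

theorem rank_koszulFlattening_prod_le [Fintype I] (α : I → K) (ℓ : σ → K) :
    (koszulFlattening fun m (x : Fin (q + 1) → σ) => α m * ∏ k, ℓ (x k)).rank ≤
      (Fintype.card σ - 1 : ℕ) :=
  koszulFlattening_prod (q := q) α ℓ ▸
    (LinearMap.rank_comp_le_left _ _).trans (rank_wedgePower_le ℓ)

end Koszul

section Alternating

variable {M : Type*} [AddCommGroup M] {k : ℕ}

theorem eq_zero_of_comp_swap_eq_neg [IsAddTorsionFree M] {α : Type*} [LinearOrder α]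
    {F : (Fin k → α) → M}
    (halt : ∀ i j, i ≠ j → ∀ s, F (s ∘ Equiv.swap i j) = -F s)
    (hmono : ∀ s, StrictMono s → F s = 0) (s : Fin k → α) : F s = 0 := by
  have comp_perm_eq_zero (τ : Equiv.Perm (Fin k)) (s : Fin k → α) : F (s ∘ τ) = 0 → F s = 0 := by
    induction τ using Equiv.Perm.swap_induction_on' generalizing s with
    | one => exact id
    | mul_swap τ i j hij ih =>
      intro h
      exact ih s (neg_eq_zero.1 ((halt i j hij (s ∘ τ)).symm.trans h))
  by_cases hs : Function.Injective s
  · exact comp_perm_eq_zero (Tuple.sort s) s <| hmono _ <|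
      (Tuple.monotone_sort s).strictMono_of_injective (hs.comp (Equiv.injective _))
  · obtain ⟨i, j, hij, hne⟩ := Function.not_injective_iff.1 hs
    have comp_swap : s ∘ Equiv.swap i j = s := by
      simp [Equiv.comp_swap_eq_update, hij]
    exact self_eq_neg.1 ((congrArg F comp_swap).symm.trans (halt i j hne s))

variable {α β : Type*} {G : (Fin k → α) → (Fin k → β) → M}

theorem comp_swap_eq_neg_of_conj {a b : Fin k} (hab : a ≠ b)
    (hsymm : ∀ (τ : Equiv.Perm (Fin k)) s t, G (s ∘ τ) (t ∘ τ) = G s t)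
    (halt : ∀ s t, G s (t ∘ Equiv.swap a b) = -G s t) {i j : Fin k} (hij : i ≠ j)
    (s : Fin k → α) (t : Fin k → β) : G s (t ∘ Equiv.swap i j) = -G s t := by
  obtain ⟨τ, hτ⟩ := isConj_iff.1 (Equiv.Perm.isConj_swap hab hij)
  have swap_comp : Equiv.swap i j ∘ τ = τ ∘ Equiv.swap a b := by
    rw [← Equiv.Perm.coe_mul, ← Equiv.Perm.coe_mul, ← hτ, inv_mul_cancel_right]
  calc G s (t ∘ Equiv.swap i j) = G (s ∘ τ) ((t ∘ τ) ∘ Equiv.swap a b) := by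
        rw [← hsymm τ, Function.comp_assoc, swap_comp, Function.comp_assoc]
    _ = -G s t := by rw [halt, hsymm]

theorem eq_zero_of_pair_comp_swap_eq_neg [IsAddTorsionFree M] [LinearOrder α] [LinearOrder β]
    {a b : Fin k} (hab : a ≠ b) (hsymm : ∀ (τ : Equiv.Perm (Fin k)) s t, G (s ∘ τ) (t ∘ τ) = G s t)
    (halt : ∀ s t, G s (t ∘ Equiv.swap a b) = -G s t)
    (hmono : ∀ s t, StrictMono s → StrictMono t → G s t = 0) (s : Fin k → α) (t : Fin k → β) :
    G s t = 0 := by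
  have swap_right {i j : Fin k} (hij : i ≠ j) (s t) : G s (t ∘ Equiv.swap i j) = -G s t :=
    comp_swap_eq_neg_of_conj hab hsymm halt hij s t
  have swap_left {i j : Fin k} (hij : i ≠ j) (s t) : G (s ∘ Equiv.swap i j) t = -G s t := by
    rw [← hsymm (Equiv.swap i j) s t, swap_right hij, neg_neg]
  exact eq_zero_of_comp_swap_eq_neg (fun i j hij s => swap_left hij s t)
    (fun s hs => eq_zero_of_comp_swap_eq_neg (fun i j hij t => swap_right hij s t)
      (fun t ht => hmono s t hs ht) t) s

end Alternating

section KernelBound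

variable {I α β : Type*} [Fintype I] {q : ℕ}

theorem contraction_eq_zero_of_prod_strictMono {R : Type*} [CommRing R] [IsAddTorsionFree R]
    [LinearOrder α] [LinearOrder β] {φ : I → (Fin (q + 2) → α × β) → R}
    (hsymm : ∀ m x (τ : Equiv.Perm (Fin (q + 2))), φ m (x ∘ τ) = φ m x)
    (halt : ∀ m (s : Fin (q + 2) → α) (t : Fin (q + 2) → β),
      φ m (Function.prod s (t ∘ Equiv.swap 0 1)) = -φ m (Function.prod s t))
    {c : I × α × β → R} (hc : koszulFlattening φ c = 0)
    (hmono : ∀ (s : Fin (q + 3) → α) (t : Fin (q + 3) → β), StrictMono s → StrictMono t →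
      contraction φ c (Function.prod s t) = 0) : contraction φ c = 0 := by
  have comp_swap_eq_neg (s : Fin (q + 3) → α) (t : Fin (q + 3) → β) :
      contraction φ c (Function.prod s (t ∘ Equiv.swap (Fin.succ 0) (Fin.succ 1))) =
        -contraction φ c (Function.prod s t) := by
    rw [contraction_apply, contraction_apply, ← Finset.sum_neg_distrib]
    refine Finset.sum_congr rfl fun m _ => ?_
    have tail_eq_neg := halt m (Fin.tail s) (Fin.tail t)
    rw [← tail_comp_swap_succ] at tail_eq_neg
    rw [Function.prod_apply, Function.comp_apply, Equiv.swap_apply_of_ne_of_ne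
      (Fin.succ_ne_zero _).symm (Fin.succ_ne_zero _).symm]
    exact (congrArg _ tail_eq_neg).trans (mul_neg _ _)
  ext x
  exact eq_zero_of_pair_comp_swap_eq_neg (G := fun s t => contraction φ c (Function.prod s t))
    ((Fin.succ_injective _).ne zero_ne_one)
    (fun τ s t => contraction_comp_perm hsymm hc τ (Function.prod s t))
    comp_swap_eq_neg hmono (Prod.fst ∘ x) (Prod.snd ∘ x)

theorem card_orderEmbedding_fin (k : ℕ) (α : Type*) [Fintype α] [LinearOrder α] :
    Fintype.card (Fin k ↪o α) = (Fintype.card α).choose k := by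
  rw [← Nat.card_eq_fintype_card, Nat.card_congr Set.powersetCard.ofFinEmbEquiv,
    Set.powersetCard.card, Nat.card_eq_fintype_card]

/-- A fully symmetric tensor of pairs that alternates in the second components also alternates in
the first ones, so it is determined by its values at pairs of increasing words. -/
theorem finrank_ker_koszulFlattening_le {K : Type*} [Field K] [CharZero K]
    [Fintype α] [LinearOrder α] [Fintype β] [LinearOrder β] {φ : I → (Fin (q + 2) → α × β) → K}
    (hφ : LinearIndependent K φ)
    (hsymm : ∀ m x (τ : Equiv.Perm (Fin (q + 2))), φ m (x ∘ τ) = φ m x)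
    (halt : ∀ m (s : Fin (q + 2) → α) (t : Fin (q + 2) → β),
      φ m (Function.prod s (t ∘ Equiv.swap 0 1)) = -φ m (Function.prod s t)) :
    Module.finrank K (LinearMap.ker (koszulFlattening φ)) ≤
      (Fintype.card α).choose (q + 3) * (Fintype.card β).choose (q + 3) := by
  let values : (I × α × β → K) →ₗ[K] ((Fin (q + 3) ↪o α) × (Fin (q + 3) ↪o β) → K) :=
    LinearMap.funLeft K K (fun f => Function.prod f.1 f.2) ∘ₗ contraction φ
  have injective_values :
      Function.Injective (values.domRestrict (LinearMap.ker (koszulFlattening φ))) := by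
    refine (injective_iff_map_eq_zero _).2 fun c hc => Subtype.ext ?_
    refine contraction_injective hφ (.trans ?_ (map_zero _).symm)
    exact contraction_eq_zero_of_prod_strictMono hsymm halt c.2 fun s t hs ht =>
      congrFun hc (.ofStrictMono s hs, .ofStrictMono t ht)
  refine (LinearMap.finrank_le_finrank_of_injective injective_values).trans_eq ?_
  rw [Module.finrank_fintype_fun_eq_card, Fintype.card_prod, card_orderEmbedding_fin,
    card_orderEmbedding_fin]

end KernelBound

section Minors

variable {R : Type*} [CommRing R] {d q : ℕ}

/-- The increasing enumeration of the complement of the range of `f`. -/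
def complWord (f : Fin q ↪o Fin (d + q)) : Fin d ↪o Fin (d + q) :=
  Set.powersetCard.ofFinEmbEquiv.symm
    (Set.powersetCard.compl (Fintype.card_fin _).symm (Set.powersetCard.ofFinEmbEquiv f))

theorem mem_range_complWord {f : Fin q ↪o Fin (d + q)} {a : Fin (d + q)} :
    a ∈ Set.range (complWord f) ↔ a ∉ Set.range f := by
  rw [complWord, Set.powersetCard.mem_range_ofFinEmbEquiv_symm_iff_mem,
    Set.powersetCard.mem_compl, Set.powersetCard.mem_ofFinEmbEquiv_iff_mem_range]

/-- The sign of the concatenation of `complWord f` and `s`. For `s` with the same range as `f`, it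
is the sign attached to `s` in the Laplace expansion along the complement of that range. -/
def laplaceSign (f : Fin q ↪o Fin (d + q)) (s : Fin q → Fin (d + q)) : R :=
  mapSign (Fin.append (complWord f) s)

theorem laplaceSign_comp_perm (f : Fin q ↪o Fin (d + q)) (s : Fin q → Fin (d + q))
    (τ : Equiv.Perm (Fin q)) :
    (laplaceSign f (s ∘ τ) : R) = (Equiv.Perm.sign τ : ℤ) * laplaceSign f s := by
  have append_comp : Fin.append (complWord f) (s ∘ τ) = Fin.append (complWord f) s ∘
      finSumFinEquiv.permCongr (Equiv.Perm.sumCongr 1 τ) := by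
    ext1 i
    cases i using Fin.addCases <;> simp
  simp [laplaceSign, append_comp, mapSign_comp_perm, Equiv.Perm.sign_permCongr,
    Equiv.Perm.sign_sumCongr]

theorem laplaceSign_ne_zero_iff [Nontrivial R] {f g : Fin q ↪o Fin (d + q)} :
    (laplaceSign f g : R) ≠ 0 ↔ f = g := by
  rw [laplaceSign, mapSign_ne_zero_iff, Fin.append_injective_iff,
    ← Set.powersetCard.ofFinEmbEquiv.injective.eq_iff, eq_comm, Set.powersetCard.eq_iff_subset]
  have range_subset_iff : (∀ i j, complWord f i ≠ g j) ↔ Set.range g ⊆ Set.range f := by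
    constructor
    · rintro h _ ⟨j, rfl⟩
      by_contra hj
      obtain ⟨i, hi⟩ := mem_range_complWord.2 hj
      exact h i j hi
    · exact fun h i j hij => mem_range_complWord.1 ⟨i, hij⟩ (h ⟨j, rfl⟩)
  simp only [range_subset_iff, RelEmbedding.injective, true_and, Set.subset_def,
    ← Set.powersetCard.mem_ofFinEmbEquiv_iff_mem_range]
  rfl

/-- The family of tensors representing the minors of size `q` of the generic matrix of size `d + q`;
the rows and columns of the minor are the ranges of `m.1` and `m.2`. -/
def minorTensor (m : (Fin q ↪o Fin (d + q)) × (Fin q ↪o Fin (d + q)))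
    (x : Fin q → Fin (d + q) × Fin (d + q)) : R :=
  laplaceSign m.1 (Prod.fst ∘ x) * laplaceSign m.2 (Prod.snd ∘ x)

theorem minorTensor_comp_perm (m : (Fin q ↪o Fin (d + q)) × (Fin q ↪o Fin (d + q)))
    (x : Fin q → Fin (d + q) × Fin (d + q)) (τ : Equiv.Perm (Fin q)) :
    (minorTensor m (x ∘ τ) : R) = minorTensor m x := by
  have sign_mul_self : ((Equiv.Perm.sign τ : ℤ) : R) * (Equiv.Perm.sign τ : ℤ) = 1 := by
    rw [← Int.cast_mul, ← Units.val_mul, Int.units_mul_self, Units.val_one, Int.cast_one]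
  simp only [minorTensor, ← Function.comp_assoc, laplaceSign_comp_perm]
  rw [mul_mul_mul_comm, sign_mul_self, one_mul]

theorem minorTensor_prod_comp_swap (m : (Fin q ↪o Fin (d + q)) × (Fin q ↪o Fin (d + q)))
    (s t : Fin q → Fin (d + q)) {i j : Fin q} (hij : i ≠ j) :
    (minorTensor m (Function.prod s (t ∘ Equiv.swap i j)) : R) =
      -minorTensor m (Function.prod s t) := by
  simp [minorTensor, laplaceSign_comp_perm, Equiv.Perm.sign_swap hij]

theorem minorTensor_prod_ne_zero_iff [IsDomain R]
    {m m' : (Fin q ↪o Fin (d + q)) × (Fin q ↪o Fin (d + q))} :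
    (minorTensor m (Function.prod m'.1 m'.2) : R) ≠ 0 ↔ m = m' := by
  simp only [minorTensor, Function.fst_comp_prod, Function.snd_comp_prod, mul_ne_zero_iff,
    laplaceSign_ne_zero_iff, Prod.ext_iff]

theorem linearIndependent_minorTensor [IsDomain R] :
    LinearIndependent R (minorTensor (R := R) (d := d) (q := q)) := by
  refine Fintype.linearIndependent_iff.2 fun c hc m => ?_
  have eval_eq_zero := congrFun hc (Function.prod m.1 m.2)
  rw [Finset.sum_apply, Finset.sum_eq_single m] at eval_eq_zero
  · exact (mul_eq_zero.1 eval_eq_zero).resolve_right (minorTensor_prod_ne_zero_iff.2 rfl)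
  · intro m' _ hm
    have := not_not.1 (mt (minorTensor_prod_ne_zero_iff (R := R)).1 hm)
    simp [this]
  · simp

end Minors

section DerivativeTensors

variable {R I σ : Type*} [CommRing R] {d q : ℕ}

/-- The partial derivatives of order `d` of a form of degree `d + q` along the coordinate vectors
`e (u m k)`, as symmetric tensors with `q` slots. -/
def derivativeTensors [DecidableEq σ] (u : I → Fin d → σ) :
    MvPolynomial σ R →ₗ[R] (I → (Fin q → σ) → R) :=
  LinearMap.pi fun m => LinearMap.pi fun x => polarization (Fin.append (u m) x)

theorem derivativeTensors_apply [DecidableEq σ] (u : I → Fin d → σ) (P : MvPolynomial σ R) (m : I)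
    (x : Fin q → σ) : derivativeTensors u P m x = polarization (Fin.append (u m) x) P := rfl

theorem derivativeTensors_det : derivativeTensors
    (fun m : (Fin q ↪o Fin (d + q)) × (Fin q ↪o Fin (d + q)) =>
      Function.prod (complWord m.1) (complWord m.2))
    (Matrix.mvPolynomialX (Fin (d + q)) (Fin (d + q)) R).det = minorTensor := by
  ext m x
  have append_prod : Fin.append (Function.prod (complWord m.1) (complWord m.2)) x =
      fun k => (Fin.append (complWord m.1) (Prod.fst ∘ x) k,
        Fin.append (complWord m.2) (Prod.snd ∘ x) k) := by
    ext1 i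
    cases i using Fin.addCases <;> simp
  rw [derivativeTensors_apply, append_prod, polarization_det]
  rfl

theorem derivativeTensors_pow [DecidableEq σ] (u : I → Fin d → σ) {ℓ : MvPolynomial σ R}
    (hℓ : ℓ.IsHomogeneous 1) : derivativeTensors (q := q) u (ℓ ^ (d + q)) = fun m x =>
      ((d + q).factorial * ∏ k, ℓ.coeff (Finsupp.single (u m k) 1)) *
        ∏ k, ℓ.coeff (Finsupp.single (x k) 1) := by
  ext m x
  have polarization_append := polarization_pow (Fin.append (u m) x) hℓ
  rw [Fintype.card_fin] at polarization_append
  rw [derivativeTensors_apply, polarization_append]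
  simp only [Fin.prod_univ_add, Fin.append_left, Fin.append_right, mul_assoc]

theorem rank_koszulFlattening_derivativeTensors_le_of_mem_zariskiClosure [Fintype I] [Fintype σ]
    [DecidableEq σ] (u : I → Fin d → σ) {r : ℕ} {P : homogeneousSubmodule σ ℂ (d + (q + 1))}
    (hP : P ∈ zariskiClosure {T | symmetricRank (d + (q + 1)) T = (r : ℕ∞)}) :
    (koszulFlattening (derivativeTensors (q := q + 1) u (P : MvPolynomial σ ℂ))).rank ≤
      (r * (Fintype.card σ - 1) : ℕ) := by
  refine rank_le_of_mem_zariskiClosure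
    (koszulFlattening ∘ₗ derivativeTensors u ∘ₗ Submodule.subtype _) (fun T hT => ?_) hP
  obtain ⟨v, hv, hsum⟩ := mem_powerSumLengths_of_symmetricRank_eq hT
  have rank_pow_le (i : Fin r) :
      (koszulFlattening (derivativeTensors (q := q + 1) u (v i ^ (d + (q + 1))))).rank ≤
        (Fintype.card σ - 1 : ℕ) :=
    derivativeTensors_pow u (hv i) ▸
      rank_koszulFlattening_prod_le _ fun a => (v i).coeff (Finsupp.single a 1)
  rw [LinearMap.comp_apply, LinearMap.comp_apply, Submodule.subtype_apply, hsum, map_sum, map_sum]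
  refine (LinearMap.rank_finsetSum_le _ _).trans ?_
  simpa using Finset.sum_le_sum fun i (_ : i ∈ Finset.univ) => rank_pow_le i

end DerivativeTensors

section Determinant

variable {d q : ℕ}

theorem choose_sq_mul_sq_le_of_detForm_mem_zariskiClosure {r : ℕ} (hq : 2 ≤ q)
    (h : detForm (d + q) ∈ zariskiClosure {T | symmetricRank (d + q) T = (r : ℕ∞)}) :
    (d + q).choose q ^ 2 * (d + q) ^ 2 ≤
      r * ((d + q) ^ 2 - 1) + (d + q).choose (q + 1) ^ 2 := by
  obtain ⟨q, rfl⟩ := Nat.exists_eq_add_of_le' hq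
  let flattening := koszulFlattening (minorTensor (R := ℂ) (d := d) (q := q + 2))
  have rank_le : flattening.rank ≤ (r * ((d + (q + 2)) ^ 2 - 1) : ℕ) := by
    have := rank_koszulFlattening_derivativeTensors_le_of_mem_zariskiClosure
      (fun m : (Fin (q + 2) ↪o Fin (d + (q + 2))) × (Fin (q + 2) ↪o Fin (d + (q + 2))) =>
        Function.prod (complWord m.1) (complWord m.2)) h
    rw [detForm, derivativeTensors_det] at this
    simpa [sq] using this
  have finrank_ker_le : Module.finrank ℂ (LinearMap.ker flattening) ≤
      (d + (q + 2)).choose (q + 3) ^ 2 := by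
    simpa [sq] using finrank_ker_koszulFlattening_le linearIndependent_minorTensor
      minorTensor_comp_perm fun m s t => minorTensor_prod_comp_swap m s t zero_ne_one
  have card_domain : Fintype.card (((Fin (q + 2) ↪o Fin (d + (q + 2))) ×
      (Fin (q + 2) ↪o Fin (d + (q + 2)))) × Fin (d + (q + 2)) × Fin (d + (q + 2))) =
      (d + (q + 2)).choose (q + 2) ^ 2 * (d + (q + 2)) ^ 2 := by
    simp [card_orderEmbedding_fin, sq]
  calc (d + (q + 2)).choose (q + 2) ^ 2 * (d + (q + 2)) ^ 2
      = Module.finrank ℂ (LinearMap.range flattening) +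
        Module.finrank ℂ (LinearMap.ker flattening) := by
        rw [LinearMap.finrank_range_add_finrank_ker, Module.finrank_fintype_fun_eq_card,
          card_domain]
    _ ≤ _ := add_le_add (Module.finrank_le_of_rank_le rank_le) finrank_ker_le

theorem coe_le_iInf_natCast {A : Set ℕ} {x : ℝ} (h : ∀ r ∈ A, x ≤ r) :
    (x : EReal) ≤ ((⨅ r ∈ A, (r : ℕ∞) : ℕ∞) : EReal) := by
  rcases A.eq_empty_or_nonempty with rfl | hA
  · simp
  · rw [← ENat.natCast_sInf hA]
    exact (EReal.coe_le_coe_iff.2 (h _ (Nat.sInf_mem hA))).trans_eq rfl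

theorem le_symmetricBorderRank_detForm (d : ℕ) (hq : 2 ≤ q) :
    (((1 + (q + 1 - d) / ((d + q - 1) * (q + 1) ^ 2)) * (d + q).choose q ^ 2 : ℝ) : EReal) ≤
      (symmetricBorderRank (d + q) (detForm (d + q)) : ℕ∞) := by
  refine coe_le_iInf_natCast fun r hr => ?_
  have choose_succ : ((d + q).choose (q + 1) : ℝ) = (d + q).choose q * d / (q + 1) := by
    rw [eq_div_iff (by positivity)]
    have choose_mul := Nat.choose_succ_right_eq (d + q) q
    rw [Nat.add_sub_cancel] at choose_mul
    exact_mod_cast choose_mul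
  have one_lt : (1 : ℝ) < d + q := by exact_mod_cast hq.trans (Nat.le_add_left q d)
  have sq_sub_one_pos : (0 : ℝ) < (d + q) ^ 2 - 1 := by nlinarith
  have bound : ((d + q).choose q : ℝ) ^ 2 * (d + q) ^ 2 ≤
      r * ((d + q) ^ 2 - 1) + ((d + q).choose (q + 1) : ℝ) ^ 2 := by
    have := choose_sq_mul_sq_le_of_detForm_mem_zariskiClosure hq hr
    have one_le_sq : 1 ≤ (d + q) ^ 2 := Nat.one_le_pow _ _ (by omega)
    exact_mod_cast this
  rw [choose_succ, ← sub_le_iff_le_add] at bound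
  refine le_of_mul_le_mul_right (bound.trans' (le_of_eq ?_)) sq_sub_one_pos
  have : (d + q - 1 : ℝ) ≠ 0 := by linarith
  have : (q + 1 : ℝ) ≠ 0 := by positivity
  field_simp
  ring

end Determinant

end DetBorderRank

end

theorem mainTheorem2 (n : ℕ) (hn : 3 ≤ n) :
    (Even n →
      (((1 + 4 / (((n : ℝ) - 1) * ((n : ℝ) + 2) ^ 2)) * (n.choose (n / 2) : ℝ) ^ 2 : ℝ) : EReal) ≤
        ((DetBorderRank.symmetricBorderRank n (DetBorderRank.detForm n) : ℕ∞) : EReal)) ∧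
    (Odd n →
      (((1 + 8 / (((n : ℝ) - 1) * ((n : ℝ) + 3) ^ 2)) * (n.choose ((n - 1) / 2) : ℝ) ^ 2 : ℝ) :
          EReal) ≤
        ((DetBorderRank.symmetricBorderRank n (DetBorderRank.detForm n) : ℕ∞) : EReal)) := by
  constructor
  · rintro ⟨k, rfl⟩
    have bound := DetBorderRank.le_symmetricBorderRank_detForm k (q := k) (by omega)
    rw [show (k + k) / 2 = k by omega]
    refine le_of_eq_of_le (congrArg _ (congrArg (· * _) ?_)) bound
    push_cast
    have : (k : ℝ) + k - 1 ≠ 0 := sub_ne_zero.2 (by exact_mod_cast (by omega : k + k ≠ 1))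
    have : (k : ℝ) + k + 2 ≠ 0 := by positivity
    field_simp
    ring
  · rintro ⟨k, rfl⟩
    have bound := DetBorderRank.le_symmetricBorderRank_detForm k (q := k + 1) (by omega)
    rw [show 2 * k + 1 = k + (k + 1) by ring, show (k + (k + 1) - 1) / 2 = k by omega,
      Nat.choose_symm_add]
    refine le_of_eq_of_le (congrArg _ (congrArg (· * _) ?_)) bound
    push_cast
    field_simp
    ring
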